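/- For $\gamma>0$ let $\mathbb{H}_{\gamma}=\{(z_1,z_2)\in\mathbb{C}^2 : |z_1|^{\gamma}<|z_2|<1\}$ be the generalized Hartogs triangle of exponent $\gamma$. For a domain $\Omega\subset\mathbb{C}^n$ let $A^2(\Omega)$ be the Bergman space of holomorphic functions on $\Omega$ that are square-integrable with respect to Lebesgue measure $dV$. The Bergman kernel of $\Omega$ is the unique conjugate symmetric function $\mathbb{B}_{\Omega}:\Omega\times\Omega\to\mathbb{C}$ such that $\mathbb{B}_{\Omega}(\cdot,w)\in A^2(\Omega)$ for every $w\in\Omega$ and $f(z)=\int_{\Omega}\mathbb{B}_{\Omega}(z,w)f(w)\,dV(w)$ for all $f\in A^2(\Omega)$ and $z\in\Omega$. The domain $\Omega$ is called a Lu Qi-Keng domain if $\mathbb{B}_{\Omega}(z,w)\neq 0$ for all $z,w\in\Omega$. Corollary. For every positive integer $k$, the Hartogs triangle $\mathbb{H}_{1/k}$ is a Lu Qi-Keng domain. -/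

import Mathlib

open MeasureTheory

/-- The generalized Hartogs triangle of exponent `γ`, a subset of `ℂ²`:
`{(z₁, z₂) : |z₁| ^ γ < |z₂| < 1}`. -/
def generalizedHartogsTriangle (γ : ℝ) : Set (Fin 2 → ℂ) :=
  {z | ‖z 0‖ ^ γ < ‖z 1‖ ∧ ‖z 1‖ < 1}

/-- The Bergman space `A²(Ω)` of `Ω ⊆ ℂⁿ`: the functions that are holomorphic on `Ω` and
square-integrable on `Ω` for Lebesgue measure. Values outside `Ω` are irrelevant. -/
def bergmanSpace {n : ℕ} (Ω : Set (Fin n → ℂ)) : Set ((Fin n → ℂ) → ℂ) :=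
  {f | DifferentiableOn ℂ f Ω ∧ MemLp f 2 (volume.restrict Ω)}

/-- `B` has the characteristic properties of the Bergman kernel of `Ω`: it is in the Bergman space
as a function of its first variable, it is conjugate symmetric, and it reproduces the functions of
the Bergman space. (The integrand is a product of two square-integrable functions.) -/
structure IsBergmanKernel {n : ℕ} (Ω : Set (Fin n → ℂ))
    (B : (Fin n → ℂ) → (Fin n → ℂ) → ℂ) : Prop where
  mem : ∀ w ∈ Ω, (fun z => B z w) ∈ bergmanSpace Ω
  conj_symm : ∀ z ∈ Ω, ∀ w ∈ Ω, B w z = starRingEnd ℂ (B z w)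
  reproducing : ∀ f ∈ bergmanSpace Ω, ∀ z ∈ Ω, f z = ∫ w in Ω, B z w * f w

/-- A Bergman kernel is unique on `Ω × Ω`. -/
theorem IsBergmanKernel.eq {n : ℕ} {Ω : Set (Fin n → ℂ)} (hΩ : IsOpen Ω)
    {B C : (Fin n → ℂ) → (Fin n → ℂ) → ℂ}
    (hB : IsBergmanKernel Ω B) (hC : IsBergmanKernel Ω C)
    {z w : Fin n → ℂ} (hz : z ∈ Ω) (hw : w ∈ Ω) : B z w = C z w := by
  rw [hC.reproducing _ (hB.mem w hw) z hz, hC.conj_symm w hw z hz,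
    hB.reproducing _ (hC.mem z hz) w hw, ← integral_conj]
  refine setIntegral_congr_fun hΩ.measurableSet fun u hu => ?_
  simp only [map_mul]
  rw [← hC.conj_symm u hu z hz, ← hB.conj_symm w hw u hu, mul_comm]

open Classical in
/-- The Bergman kernel of `Ω`: the unique function on `Ω × Ω` with the properties listed in
`IsBergmanKernel`, extended by `0` (and, as a convention, `0` if there were no such function). -/
noncomputable def bergmanKernel {n : ℕ} (Ω : Set (Fin n → ℂ)) (z w : Fin n → ℂ) : ℂ :=
  if h : (∃ B, IsBergmanKernel Ω B) ∧ z ∈ Ω ∧ w ∈ Ω then h.1.choose z w else 0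

/-- On `Ω × Ω` the function `bergmanKernel Ω` is equal to any function with the properties of the
Bergman kernel. -/
theorem IsBergmanKernel.bergmanKernel_eq {n : ℕ} {Ω : Set (Fin n → ℂ)} (hΩ : IsOpen Ω)
    {B : (Fin n → ℂ) → (Fin n → ℂ) → ℂ} (hB : IsBergmanKernel Ω B)
    {z w : Fin n → ℂ} (hz : z ∈ Ω) (hw : w ∈ Ω) : bergmanKernel Ω z w = B z w := by
  have h : (∃ B, IsBergmanKernel Ω B) ∧ z ∈ Ω ∧ w ∈ Ω := ⟨⟨B, hB⟩, hz, hw⟩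
  rw [bergmanKernel, dif_pos h]
  exact h.1.choose_spec.eq hΩ hB hz hw

/-- A Lu Qi-Keng domain in `ℂⁿ`: a domain (a nonempty connected open set) whose Bergman kernel has
no zeros. As `bergmanKernel` is `0` where it is not defined, the last condition includes that the
Bergman kernel exists. -/
structure IsLuQiKengDomain {n : ℕ} (Ω : Set (Fin n → ℂ)) : Prop where
  isOpen : IsOpen Ω
  isConnected : IsConnected Ω
  kernel_ne_zero : ∀ z ∈ Ω, ∀ w ∈ Ω, bergmanKernel Ω z w ≠ 0

/-! For exponent `1 / k` the domain is `‖z 0‖ < ‖z 1‖ ^ k`, `‖z 1‖ < 1`, and `z ↦ (z 0 / z 1 ^ k, z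
1)` straightens it to disc × punctured disc. This suggests the closed form `hartogsBergmanKernel`,
whose only possible zeros come from the numerator `(z 1 * conj (w 1)) ^ k`, and `z 1 = 0` is
excluded from the domain.

By uniqueness it suffices to check that this closed form is a Bergman kernel. The reproducing
property is verified directly, without a transformation formula. On the fibre over `v`, a disc of
radius `‖v‖ ^ k`, the kernel is a factor independent of `u` times the kernel of that disc at `c * v
^ k`, where `c = z 0 / z 1 ^ k` (`hartogsBergmanKernel_cons`). Integrating over the fibre
(`integral_ball_bergman_mul`) evaluates `f` on the curve `v ↦ (c * v ^ k, v)`. The function `v ^ k *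
f (c * v ^ k, v)` is square-integrable (`integrableOn_sq_curve`), so its singularity at `0` is
removable and the unit disc kernel reproduces it at `v = z 1`, where the curve meets `z`. -/

/-! ### The Bergman kernel of a disc -/

open Complex Real Set Metric intervalIntegral in
theorem integral_ball_eq_integral_circleMap {R : ℝ} (hR : 0 < R) {g : ℂ → ℂ}
    (hg : ContinuousOn g (ball 0 R)) (hi : IntegrableOn g (ball 0 R)) :
    ∫ w in ball 0 R, g w = ∫ r in (0 : ℝ)..R, r • ∫ θ in (0 : ℝ)..2 * π, g (circleMap 0 r θ) := by
  classical
  set F : ℂ → ℂ := (ball 0 R).indicator g with hF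
  have hFm : Measurable F := by
    have := hg.measurable_piecewise (continuousOn_const (c := (0 : ℂ)) (s := (ball (0 : ℂ) R)ᶜ))
      measurableSet_ball
    convert! this using 1
  have hFi : Integrable F := (integrable_indicator_iff measurableSet_ball).2 hi
  have hsymm : ∀ p : ℝ × ℝ, Complex.polarCoord.symm p = circleMap 0 p.1 p.2 := by
    intro p
    rw [Complex.polarCoord_symm_apply, circleMap, Complex.exp_mul_I]
    push_cast; ring
  have ht : _root_.polarCoord.target = Ioi (0 : ℝ) ×ˢ Ioo (-π) π := rfl
  -- Fubini in polar coordinates needs integrability, which is transferred through the `lintegral`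
  -- change of variables.
  have hpi : IntegrableOn (fun p : ℝ × ℝ => p.1 • F (circleMap 0 p.1 p.2))
      (Ioi 0 ×ˢ Ioo (-π) π) := by
    constructor
    · refine Measurable.aestronglyMeasurable ?_
      refine measurable_fst.smul (hFm.comp ?_)
      unfold circleMap
      fun_prop
    · rw [hasFiniteIntegral_iff_enorm]
      have h1 := Complex.lintegral_comp_polarCoord_symm (fun z => ‖F z‖ₑ)
      have h2 := hFi.hasFiniteIntegral
      rw [hasFiniteIntegral_iff_enorm, ← h1, ht] at h2
      convert! h2 using 1
      refine setLIntegral_congr_fun (measurableSet_Ioi.prod measurableSet_Ioo) fun p hp => ?_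
      have : (0 : ℝ) < p.1 := hp.1
      simp only [hsymm, enorm_smul, smul_eq_mul]
      rw [Real.enorm_eq_ofReal this.le]
  -- Polar coordinates use angles in `(-π, π)`, circle integrals use `[0, 2π]`; periodicity
  -- reconciles them.
  have hper : ∀ r : ℝ, ∫ θ in Ioo (-π) π, F (circleMap 0 r θ)
      = ∫ θ in (0 : ℝ)..2 * π, F (circleMap 0 r θ) := by
    intro r
    rw [← integral_Ioc_eq_integral_Ioo, ← integral_of_le (by linarith [pi_pos])]
    have hp : Function.Periodic (fun θ => F (circleMap 0 r θ)) (2 * π) :=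
      (periodic_circleMap 0 r).comp F
    have := hp.intervalIntegral_add_eq (-π) 0
    rw [zero_add, show -π + 2 * π = π by ring] at this
    exact this
  rw [← MeasureTheory.integral_indicator measurableSet_ball, ← hF, ← Complex.integral_comp_polarCoord_symm, ht]
  simp only [hsymm]
  rw [Measure.volume_eq_prod, setIntegral_prod _ (by rwa [← Measure.volume_eq_prod])]
  simp only [MeasureTheory.integral_smul, hper]
  rw [integral_of_le hR.le, integral_Ioc_eq_integral_Ioo]
  have hmem : ∀ r θ : ℝ, 0 < r → (circleMap 0 r θ ∈ ball (0 : ℂ) R ↔ r < R) := by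
    intro r θ hr
    rw [mem_ball_zero_iff, norm_circleMap_zero, abs_of_pos hr]
  refine (setIntegral_eq_of_subset_of_forall_sdiff_eq_zero measurableSet_Ioi
    (Ioo_subset_Ioi_self : Ioo 0 R ⊆ Ioi 0) ?_).trans ?_
  rotate_left
  · refine setIntegral_congr_fun measurableSet_Ioo fun r hr => ?_
    simp only [hF]
    congr 1
    refine integral_congr fun θ _ => ?_
    exact indicator_of_mem ((hmem r θ hr.1).2 hr.2) _
  · intro r hr
    have h0 : ∀ θ, F (circleMap 0 r θ) = 0 := fun θ =>
      indicator_of_notMem (fun h => hr.2 ⟨hr.1, (hmem r θ hr.1).1 h⟩) _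
    simp [h0]

-- On the circle of radius `r` one has `conj w = r ^ 2 / w`, which turns the antiholomorphic kernel
-- into the Cauchy kernel for the derivative of `w * h w` at `b * r ^ 2`.
open Complex Real Set Metric ComplexConjugate in
theorem integral_circleMap_bergman_mul {R r : ℝ} (hr : 0 < r) (hrR : r < R) {h : ℂ → ℂ}
    (hh : DifferentiableOn ℂ h (ball 0 R)) {b : ℂ} (hb : ‖b‖ * R < 1) :
    ∫ θ in (0 : ℝ)..2 * π, ((1 - b * conj (circleMap 0 r θ)) ^ 2)⁻¹ * h (circleMap 0 r θ)
      = 2 * π * deriv (fun w => w * h w) (b * r ^ 2) := by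
  have hbr : b * (r : ℂ) ^ 2 ∈ ball (0 : ℂ) r := by
    rw [mem_ball_zero_iff, norm_mul, norm_pow, norm_real, Real.norm_of_nonneg hr.le]
    have : ‖b‖ * r < 1 := lt_of_le_of_lt (by gcongr) hb
    nlinarith
  have key := two_pi_I_inv_smul_circleIntegral_sub_sq_inv_smul_of_differentiable
    (isOpen_ball : IsOpen (ball (0 : ℂ) R)) (closedBall_subset_ball hrR)
    (f := fun w => w * h w) (differentiableOn_id.mul hh) hbr
  rw [← key, circleIntegral, smul_eq_mul, ← intervalIntegral.integral_const_mul,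
    ← intervalIntegral.integral_const_mul]
  refine intervalIntegral.integral_congr fun θ _ => ?_
  simp only [deriv_circleMap, smul_eq_mul]
  set w := circleMap 0 r θ with hw
  have hnw : ‖w‖ = r := by rw [hw, norm_circleMap_zero, abs_of_pos hr]
  have hw0 : w ≠ 0 := by rw [← norm_pos_iff, hnw]; exact hr
  have hconj : conj w = r ^ 2 / w := by
    rw [eq_div_iff hw0, mul_comm, mul_conj, normSq_eq_norm_sq, hnw]
    push_cast; rfl
  have hne : w - b * r ^ 2 ≠ 0 := by
    intro h0
    rw [sub_eq_zero] at h0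
    rw [mem_ball_zero_iff, ← h0, hnw] at hbr
    exact lt_irrefl _ hbr
  have hpi : (π : ℂ) ≠ 0 := ofReal_ne_zero.2 pi_ne_zero
  have hI := I_ne_zero
  have : 1 - b * conj w = (w - b * r ^ 2) / w := by
    rw [hconj]; field_simp
  rw [this]
  field_simp

open Complex Real Set Metric ComplexConjugate in
/-- The Bergman kernel of a disc reproduces integrable holomorphic functions. -/
theorem integral_ball_bergman_mul {R : ℝ} {h : ℂ → ℂ}
    (hh : DifferentiableOn ℂ h (ball 0 R)) (hi : IntegrableOn h (ball 0 R)) {a : ℂ}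
    (ha : ‖a‖ < R) :
    ∫ w in ball 0 R, (R : ℂ) ^ 2 / (π * (R ^ 2 - a * conj w) ^ 2) * h w = h a := by
  have hR : 0 < R := (norm_nonneg a).trans_lt ha
  have hRC : (R : ℂ) ≠ 0 := ofReal_ne_zero.2 hR.ne'
  have hpi : (π : ℂ) ≠ 0 := ofReal_ne_zero.2 pi_ne_zero
  -- With this scaling the Cauchy point `b * r ^ 2` runs from `0` to `a` as `r` goes from `0` to
  -- `R`. It stays inside the open disc, so no boundary regularity of `h` is needed.
  set b : ℂ := a / R ^ 2 with hbdef
  have hnb : ‖b‖ = ‖a‖ / R ^ 2 := by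
    rw [hbdef, norm_div, norm_pow, norm_real, Real.norm_of_nonneg hR.le]
  have hb : ‖b‖ * R < 1 := by
    rw [hnb, div_mul_eq_mul_div, div_lt_one (by positivity)]
    nlinarith
  have hab : a = b * R ^ 2 := by rw [hbdef]; field_simp
  have hK : ∀ w, (R : ℂ) ^ 2 / (π * (R ^ 2 - a * conj w) ^ 2) * h w
      = (π * R ^ 2 : ℂ)⁻¹ * (((1 - b * conj w) ^ 2)⁻¹ * h w) := by
    intro w
    have : (R : ℂ) ^ 2 - a * conj w = R ^ 2 * (1 - b * conj w) := by rw [hab]; ring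
    rw [this, mul_pow]
    simp only [div_eq_mul_inv, mul_inv]
    rw [show ((R : ℂ) ^ 2) ^ 2 = R ^ 2 * R ^ 2 by ring, mul_inv]
    have hR2 : (R : ℂ) ^ 2 * ((R : ℂ) ^ 2)⁻¹ = 1 := mul_inv_cancel₀ (pow_ne_zero 2 hRC)
    linear_combination ((π : ℂ)⁻¹ * ((R : ℂ) ^ 2)⁻¹ * ((1 - b * conj w) ^ 2)⁻¹ * h w) * hR2
  simp only [hK]
  have hden : ∀ w ∈ closedBall (0 : ℂ) R, 1 - b * conj w ≠ 0 := by
    intro w hw h0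
    rw [mem_closedBall_zero_iff] at hw
    have h1 : ‖b * conj w‖ = 1 := by rw [← sub_eq_zero.1 h0, norm_one]
    rw [norm_mul, norm_conj] at h1
    have : ‖b‖ * ‖w‖ ≤ ‖b‖ * R := by gcongr
    linarith
  have hKc : ContinuousOn (fun w : ℂ => ((1 - b * conj w) ^ 2)⁻¹) (closedBall 0 R) := by
    refine ContinuousOn.inv₀ ?_ fun w hw => pow_ne_zero 2 (hden w hw)
    exact Continuous.continuousOn (by fun_prop)
  rw [integral_const_mul, integral_ball_eq_integral_circleMap hR
    (g := fun w => ((1 - b * conj w) ^ 2)⁻¹ * h w) ((hKc.mono ball_subset_closedBall).mul hh.continuousOn)]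
  swap
  · obtain ⟨C, hC⟩ := (isCompact_closedBall (0 : ℂ) R).exists_bound_of_continuousOn hKc
    refine Integrable.bdd_mul (c := C) hi
      ((hKc.mono ball_subset_closedBall).aestronglyMeasurable measurableSet_ball) ?_
    exact (ae_restrict_mem measurableSet_ball).mono fun w hw => hC w (ball_subset_closedBall hw)
  have hmem : ∀ r ∈ Icc 0 R, b * (r : ℂ) ^ 2 ∈ ball (0 : ℂ) R := by
    intro r hr
    rw [mem_ball_zero_iff, norm_mul, norm_pow, norm_real, Real.norm_of_nonneg hr.1]
    have h1 : ‖b‖ * r ^ 2 ≤ ‖b‖ * R ^ 2 := by gcongr; exact hr.1; exact hr.2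
    nlinarith
  have hwh : DifferentiableOn ℂ (fun w => w * h w) (ball 0 R) := differentiableOn_id.mul hh
  have hcongr : ∫ r in (0 : ℝ)..R, r • ∫ θ in (0 : ℝ)..2 * π,
        ((1 - b * conj (circleMap 0 r θ)) ^ 2)⁻¹ * h (circleMap 0 r θ)
      = ∫ r in (0 : ℝ)..R, π * (2 * r * deriv (fun w => w * h w) (b * r ^ 2)) := by
    rw [intervalIntegral.integral_of_le hR.le, intervalIntegral.integral_of_le hR.le,
      integral_Ioc_eq_integral_Ioo, integral_Ioc_eq_integral_Ioo]
    refine setIntegral_congr_fun measurableSet_Ioo fun r hr => ?_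
    simp only [integral_circleMap_bergman_mul hr.1 hr.2 hh hb, real_smul]
    ring
  -- The radial integrand is an exact derivative, so the integral reduces to `R ^ 2 * h a`.
  have hderiv : ∀ r ∈ uIcc 0 R, HasDerivAt (fun r : ℝ => (r : ℂ) ^ 2 * h (b * r ^ 2))
      (2 * r * deriv (fun w => w * h w) (b * r ^ 2)) r := by
    intro r hr
    rw [uIcc_of_le hR.le] at hr
    have hd : HasDerivAt h (deriv h (b * r ^ 2)) (b * (r : ℂ) ^ 2) :=
      (hh.differentiableAt (isOpen_ball.mem_nhds (hmem r hr))).hasDerivAt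
    have h1 : deriv (fun w => w * h w) (b * r ^ 2)
        = h (b * r ^ 2) + b * r ^ 2 * deriv h (b * r ^ 2) := by
      have := ((hasDerivAt_id (b * (r : ℂ) ^ 2)).mul hd).deriv
      simpa using! this
    have h2 : HasDerivAt (fun z : ℂ => z ^ 2 * h (b * z ^ 2))
        (2 * r * deriv (fun w => w * h w) (b * r ^ 2)) (r : ℂ) := by
      have h3 : HasDerivAt (fun z : ℂ => z ^ 2) (2 * r) (r : ℂ) := by
        simpa using hasDerivAt_pow 2 (r : ℂ)
      have h4 := h3.mul (hd.comp (r : ℂ) (h3.const_mul b))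
      convert! h4 using 1
      rw [h1]
      simp only [Function.comp]
      ring
    exact h2.comp_ofReal
  have hcont : ContinuousOn (fun r : ℝ => 2 * (r : ℂ) * deriv (fun w => w * h w) (b * r ^ 2))
      (uIcc 0 R) := by
    rw [uIcc_of_le hR.le]
    refine ContinuousOn.mul (Continuous.continuousOn (by fun_prop)) ?_
    exact (hwh.deriv isOpen_ball).continuousOn.comp (Continuous.continuousOn (by fun_prop)) hmem
  rw [hcongr, intervalIntegral.integral_const_mul,
    intervalIntegral.integral_eq_sub_of_hasDerivAt hderiv hcont.intervalIntegrable, hab]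
  simp only [ofReal_zero]
  field_simp
  ring

open Complex Real Set Metric ComplexConjugate in
/-- The mean value property over discs. -/
theorem integral_ball_eq_mul_center {c : ℂ} {R : ℝ} (hR : 0 < R) {h : ℂ → ℂ}
    (hh : DifferentiableOn ℂ h (ball c R)) (hi : IntegrableOn h (ball c R)) :
    ∫ w in ball c R, h w = π * R ^ 2 * h c := by
  have hpre : (fun w : ℂ => w + c) ⁻¹' ball c R = ball 0 R := by
    ext w; simp
  have hmp : MeasurePreserving (fun w : ℂ => w + c) := measurePreserving_add_right volume c
  have hemb : MeasurableEmbedding (fun w : ℂ => w + c) := measurableEmbedding_addRight c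
  have hi' : IntegrableOn (fun w => h (w + c)) (ball 0 R) := by
    rw [← hpre]
    exact (hmp.integrableOn_comp_preimage hemb).2 hi
  have hh' : DifferentiableOn ℂ (fun w => h (w + c)) (ball 0 R) := by
    refine hh.comp (by fun_prop) fun w hw => ?_
    rw [← hpre] at hw
    exact hw
  -- At the centre the kernel is the constant `1 / (π * R ^ 2)`.
  have key := integral_ball_bergman_mul hh' hi' (a := 0) (by simpa using hR)
  rw [← hmp.setIntegral_preimage_emb hemb, hpre]
  have hRC : (R : ℂ) ≠ 0 := ofReal_ne_zero.2 hR.ne'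
  have hpi : (π : ℂ) ≠ 0 := ofReal_ne_zero.2 pi_ne_zero
  simp only [zero_mul, sub_zero, zero_add, integral_const_mul] at key
  rw [← key]
  field_simp

/-! ### Removable singularities and the punctured disc -/

open Set Metric in
theorem integrableOn_of_sq {s : Set ℂ} {h : ℂ → ℂ} (hs : MeasurableSet s) (hfin : volume s ≠ ⊤)
    (hc : ContinuousOn h s) (hi : IntegrableOn (fun w => h w ^ 2) s) : IntegrableOn h s := by
  have h1 : IntegrableOn (fun w => 1 + ‖h w ^ 2‖) s :=
    (integrableOn_const hfin).add hi.norm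
  refine Integrable.mono' h1 (hc.aestronglyMeasurable hs) (ae_of_all _ fun w => ?_)
  rw [norm_pow]
  nlinarith [sq_nonneg (‖h w‖ - 1), sq_nonneg (‖h w‖)]

open Complex Real Set Metric Filter Topology Asymptotics in
/-- A holomorphic function on a punctured disc with integrable square has a removable
singularity. -/
theorem differentiableOn_update_limUnder_of_integrableOn_sq {R : ℝ} (hR : 0 < R) {h : ℂ → ℂ}
    (hh : DifferentiableOn ℂ h (ball 0 R \ {0}))
    (hi : IntegrableOn (fun w => h w ^ 2) (ball 0 R \ {0})) :
    DifferentiableOn ℂ (Function.update h 0 (limUnder (𝓝[≠] 0) h)) (ball 0 R) := by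
  refine Complex.differentiableOn_update_limUnder_of_isLittleO (ball_mem_nhds 0 hR) hh ?_
  set s : Set ℂ := ball 0 R \ {0} with hs
  have hball : Tendsto (fun z : ℂ => (volume.restrict s) (ball (0 : ℂ) (2 * ‖z‖))) (𝓝[≠] 0)
      (𝓝 0) := by
    have h1 : Tendsto (fun z : ℂ => volume (ball (0 : ℂ) (2 * ‖z‖))) (𝓝[≠] 0) (𝓝 0) := by
      have h2 : Continuous fun z : ℂ => ENNReal.ofReal ((2 * ‖z‖) ^ 2 * π) :=
        ENNReal.continuous_ofReal.comp (by fun_prop)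
      have h3 := (h2.tendsto 0).mono_left (nhdsWithin_le_nhds (s := {0}ᶜ))
      simp only [norm_zero, mul_zero, ne_eq, OfNat.ofNat_ne_zero, not_false_eq_true, zero_pow,
        zero_mul, ENNReal.ofReal_zero] at h3
      refine h3.congr fun z => ?_
      rw [Complex.volume_ball, ENNReal.ofReal_mul (by positivity),
        ENNReal.ofReal_pow (by positivity)]
      congr 1
      rw [ENNReal.ofReal, Real.toNNReal_of_nonneg pi_pos.le]
      rfl
    exact tendsto_of_tendsto_of_tendsto_of_le_of_le tendsto_const_nhds h1 (fun _ => zero_le)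
      fun _ => Measure.restrict_apply_le _ _
  have hint := hi.norm.tendsto_setIntegral_nhds_zero hball
  have hnear : ∀ᶠ z : ℂ in 𝓝[≠] 0, z ≠ 0 ∧ 2 * ‖z‖ < R := by
    refine eventually_mem_nhdsWithin.and (nhdsWithin_le_nhds ?_)
    exact ContinuousAt.eventually_lt (by fun_prop) continuousAt_const (by simpa using hR)
  -- Mean value property for `h ^ 2` on the disc about `z` of radius `‖z‖`, the largest that avoids
  -- the origin. The right side tends to `0` by absolute continuity of the integral.
  have hle : ∀ᶠ z : ℂ in 𝓝[≠] 0, π * ‖z * h z‖ ^ 2 ≤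
      ∫ w in ball 0 (2 * ‖z‖), ‖h w ^ 2‖ ∂volume.restrict s := by
    filter_upwards [hnear] with z hz
    have hsub2 : ball z ‖z‖ ⊆ ball 0 (2 * ‖z‖) := by
      refine ball_subset_ball' ?_
      rw [dist_zero_right]; linarith
    have hsub : ball z ‖z‖ ⊆ s := by
      intro w hw
      refine ⟨ball_subset_ball hz.2.le (hsub2 hw), fun h0 => ?_⟩
      rw [mem_singleton_iff] at h0
      simp [h0] at hw
    have hm := integral_ball_eq_mul_center (norm_pos_iff.2 hz.1) ((hh.mono hsub).pow 2)
      (hi.mono_set hsub)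
    have h1 : π * ‖z * h z‖ ^ 2 = ‖∫ w in ball z ‖z‖, h w ^ 2‖ := by
      have := congrArg norm hm
      simp only [Pi.pow_apply, norm_mul, norm_pow, norm_real, norm_norm,
        Real.norm_of_nonneg pi_pos.le] at this
      rw [this, norm_mul]; ring
    rw [h1]
    refine (norm_integral_le_integral_norm _).trans ?_
    rw [Measure.restrict_restrict measurableSet_ball]
    refine setIntegral_mono_set (IntegrableOn.mono_set hi.norm inter_subset_right)
      (ae_of_all _ fun _ => norm_nonneg _) ?_
    exact (subset_inter hsub2 hsub).eventuallyLE
  have hsq : Tendsto (fun z : ℂ => π * ‖z * h z‖ ^ 2) (𝓝[≠] 0) (𝓝 0) :=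
    tendsto_of_tendsto_of_tendsto_of_le_of_le' tendsto_const_nhds hint
      (Eventually.of_forall fun z => by positivity) hle
  have hz : Tendsto (fun z : ℂ => z * h z) (𝓝[≠] 0) (𝓝 0) := by
    rw [tendsto_zero_iff_norm_tendsto_zero]
    have h1 := ((hsq.const_mul π⁻¹).sqrt)
    simp only [mul_zero, Real.sqrt_zero] at h1
    refine h1.congr fun z => ?_
    rw [← mul_assoc, inv_mul_cancel₀ pi_ne_zero, one_mul, Real.sqrt_sq (norm_nonneg _)]
  rw [isLittleO_iff_tendsto' (eventually_mem_nhdsWithin.mono fun z hz h0 =>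
    absurd h0 (inv_ne_zero (by simpa using hz)))]
  have hz0 : Tendsto (fun z : ℂ => z * h 0) (𝓝[≠] 0) (𝓝 0) := by
    have : Continuous fun z : ℂ => z * h 0 := by fun_prop
    simpa using (this.tendsto 0).mono_left (nhdsWithin_le_nhds (s := {0}ᶜ))
  have := hz.sub hz0
  rw [sub_zero] at this
  refine this.congr fun z => ?_
  rw [sub_zero, div_inv_eq_mul]; ring

open Complex Real Set Metric ComplexConjugate in
/-- The Bergman kernel of the unit disc reproduces the Bergman space of the punctured disc. -/
theorem integral_punctured_ball_bergman_mul {h : ℂ → ℂ}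
    (hh : DifferentiableOn ℂ h (ball 0 1 \ {0}))
    (hi : IntegrableOn (fun w => h w ^ 2) (ball 0 1 \ {0})) {a : ℂ} (ha : ‖a‖ < 1) (ha0 : a ≠ 0) :
    ∫ w in ball 0 1 \ {0}, 1 / (π * (1 - a * conj w) ^ 2) * h w = h a := by
  have hsm : MeasurableSet (ball (0 : ℂ) 1 \ {0}) :=
    measurableSet_ball.diff (measurableSet_singleton 0)
  have hae : (ball (0 : ℂ) 1 \ {0} : Set ℂ) =ᵐ[volume] ball 0 1 :=
    sdiff_null_ae_eq_self (measure_singleton 0)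
  have hi1 : IntegrableOn h (ball 0 1 \ {0}) :=
    integrableOn_of_sq hsm ((measure_mono sdiff_subset).trans_lt measure_ball_lt_top).ne
      hh.continuousOn hi
  -- Once `0` is filled in, the formula of the full disc applies; the added point is null.
  have hd := differentiableOn_update_limUnder_of_integrableOn_sq one_pos hh hi
  set g := Function.update h 0 ((nhdsWithin 0 {0}ᶜ).limUnder h) with hg
  have hgh : ∀ w ∈ ball (0 : ℂ) 1 \ {0}, g w = h w := fun w hw =>
    Function.update_of_ne hw.2 _ _
  have hgi : IntegrableOn g (ball 0 1) := by
    rw [← integrableOn_congr_set_ae hae]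
    exact hi1.congr_fun (fun w hw => (hgh w hw).symm) hsm
  have key := integral_ball_bergman_mul hd hgi ha
  rw [← setIntegral_congr_set hae, hgh a ⟨by simpa using ha, ha0⟩] at key
  rw [← key]
  refine setIntegral_congr_fun hsm fun w hw => ?_
  simp only [hgh w hw, ofReal_one, one_pow]

/-! ### Geometry of the Hartogs triangle -/

open Set Metric in
theorem mem_generalizedHartogsTriangle_one_div {k : ℕ} (hk : 0 < k) {z : Fin 2 → ℂ} :
    z ∈ generalizedHartogsTriangle (1 / (k : ℝ)) ↔ ‖z 0‖ < ‖z 1‖ ^ k ∧ ‖z 1‖ < 1 := by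
  simp only [generalizedHartogsTriangle, mem_ofPred_eq, one_div]
  rw [Real.rpow_inv_lt_iff_of_pos (norm_nonneg _) (norm_nonneg _) (by exact_mod_cast hk),
    Real.rpow_natCast]

theorem ne_zero_of_mem_generalizedHartogsTriangle {k : ℕ} (hk : 0 < k) {z : Fin 2 → ℂ}
    (hz : z ∈ generalizedHartogsTriangle (1 / (k : ℝ))) : z 1 ≠ 0 := by
  intro h
  have := ((mem_generalizedHartogsTriangle_one_div hk).1 hz).1
  rw [h, norm_zero, zero_pow hk.ne'] at this
  exact absurd this (norm_nonneg _).not_gt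

open Set Metric in
theorem cons_mem_generalizedHartogsTriangle_iff {k : ℕ} (hk : 0 < k) {u v : ℂ} :
    ![u, v] ∈ generalizedHartogsTriangle (1 / (k : ℝ)) ↔
      v ∈ ball (0 : ℂ) 1 \ {0} ∧ u ∈ ball (0 : ℂ) (‖v‖ ^ k) := by
  refine ⟨fun h => ⟨⟨?_, ne_zero_of_mem_generalizedHartogsTriangle hk h⟩, ?_⟩, fun h => ?_⟩
  · simpa using ((mem_generalizedHartogsTriangle_one_div hk).1 h).2
  · simpa using ((mem_generalizedHartogsTriangle_one_div hk).1 h).1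
  · rw [mem_generalizedHartogsTriangle_one_div hk]
    simpa using And.intro h.2 h.1.1

theorem isOpen_generalizedHartogsTriangle {k : ℕ} (hk : 0 < k) :
    IsOpen (generalizedHartogsTriangle (1 / (k : ℝ))) := by
  have : generalizedHartogsTriangle (1 / (k : ℝ)) =
      {z | ‖z 0‖ < ‖z 1‖ ^ k} ∩ {z | ‖z 1‖ < 1} :=
    Set.ext fun z => mem_generalizedHartogsTriangle_one_div hk
  rw [this]
  exact (isOpen_lt (by fun_prop) (by fun_prop)).inter (isOpen_lt (by fun_prop) (by fun_prop))

-- Polar coordinates for `z 1` make the domain a continuous image of disc × interval × line, a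
-- product of connected sets.
open Set Metric Complex in
theorem isConnected_generalizedHartogsTriangle {k : ℕ} (hk : 0 < k) :
    IsConnected (generalizedHartogsTriangle (1 / (k : ℝ))) := by
  let φ : ℂ × ℝ × ℝ → Fin 2 → ℂ := fun p => ![p.1 * circleMap 0 p.2.1 p.2.2 ^ k,
    circleMap 0 p.2.1 p.2.2]
  have hφ : Continuous φ := by
    have : Continuous fun p : ℂ × ℝ × ℝ => circleMap 0 p.2.1 p.2.2 := by
      unfold circleMap; fun_prop
    refine continuous_pi fun i => ?_
    fin_cases i
    · exact continuous_fst.mul (this.pow k)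
    · exact this
  have himage : generalizedHartogsTriangle (1 / (k : ℝ)) =
      φ '' (ball (0 : ℂ) 1 ×ˢ Ioo (0 : ℝ) 1 ×ˢ (univ : Set ℝ)) := by
    ext z
    constructor
    · intro hz
      have h0 := ne_zero_of_mem_generalizedHartogsTriangle hk hz
      have h1 := (mem_generalizedHartogsTriangle_one_div hk).1 hz
      have hc : circleMap 0 ‖z 1‖ (arg (z 1)) = z 1 := by
        rw [circleMap, zero_add, norm_mul_exp_arg_mul_I]
      refine ⟨(z 0 / z 1 ^ k, ‖z 1‖, arg (z 1)), ⟨?_, ⟨norm_pos_iff.2 h0, h1.2⟩, mem_univ _⟩, ?_⟩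
      · have : 0 < ‖z 1‖ ^ k := pow_pos (norm_pos_iff.2 h0) k
        rw [mem_ball_zero_iff, norm_div, norm_pow, div_lt_one this]
        exact h1.1
      · funext i
        fin_cases i
        · simp [φ, hc, h0]
        · simp [φ, hc]
    · rintro ⟨p, ⟨hp1, hp2, -⟩, rfl⟩
      have hn : ‖circleMap 0 p.2.1 p.2.2‖ = p.2.1 := by
        rw [norm_circleMap_zero, abs_of_pos hp2.1]
      rw [mem_ball_zero_iff] at hp1
      rw [mem_generalizedHartogsTriangle_one_div hk]
      simp only [φ, Matrix.cons_val_zero, Matrix.cons_val_one, norm_mul, norm_pow, hn]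
      exact ⟨mul_lt_of_lt_one_left (pow_pos hp2.1 k) hp1, hp2.2⟩
  rw [himage]
  refine IsConnected.image ?_ φ hφ.continuousOn
  exact ((convex_ball _ _).isConnected (nonempty_ball.2 one_pos)).prod
    ((isConnected_Ioo one_pos).prod isConnected_univ)

/-! ### Integration over the fibres of `z ↦ z 1` -/

section Fubini

open Set Metric

variable {E : Type*} [NormedAddCommGroup E] {k : ℕ} {F : (Fin 2 → ℂ) → E}

theorem indicator_generalizedHartogsTriangle_cons {M : Type*} [Zero M] (hk : 0 < k)
    (F : (Fin 2 → ℂ) → M) (u v : ℂ) :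
    (generalizedHartogsTriangle (1 / (k : ℝ))).indicator F ![u, v] =
      (ball (0 : ℂ) 1 \ {0}).indicator
        (fun v => (ball (0 : ℂ) (‖v‖ ^ k)).indicator (fun u => F ![u, v]) u) v := by
  by_cases hv : v ∈ ball (0 : ℂ) 1 \ {0}
  · rw [indicator_of_mem hv]
    by_cases hu : u ∈ ball (0 : ℂ) (‖v‖ ^ k)
    · rw [indicator_of_mem hu,
        indicator_of_mem ((cons_mem_generalizedHartogsTriangle_iff hk).2 ⟨hv, hu⟩)]
    · rw [indicator_of_notMem hu, indicator_of_notMem fun h =>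
        hu ((cons_mem_generalizedHartogsTriangle_iff hk).1 h).2]
  · rw [indicator_of_notMem hv, indicator_of_notMem fun h =>
      hv ((cons_mem_generalizedHartogsTriangle_iff hk).1 h).1]

theorem measurableSet_punctured_ball : MeasurableSet (ball (0 : ℂ) 1 \ {0}) :=
  measurableSet_ball.diff (measurableSet_singleton 0)

theorem integrable_indicator_generalizedHartogsTriangle (hk : 0 < k)
    (hF : IntegrableOn F (generalizedHartogsTriangle (1 / (k : ℝ)))) :
    Integrable (fun p : ℂ × ℂ => (generalizedHartogsTriangle (1 / (k : ℝ))).indicator F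
      ![p.1, p.2]) (volume.prod volume) := by
  have h1 := (integrable_indicator_iff
    (isOpen_generalizedHartogsTriangle hk).measurableSet).2 hF
  exact ((volume_preserving_finTwoArrow ℂ).symm.integrable_comp_emb
    (MeasurableEquiv.measurableEmbedding _)).2 h1

theorem integrableOn_slice_generalizedHartogsTriangle (hk : 0 < k)
    (hF : IntegrableOn F (generalizedHartogsTriangle (1 / (k : ℝ)))) :
    ∀ᵐ v ∂volume.restrict (ball (0 : ℂ) 1 \ {0}),
      IntegrableOn (fun u => F ![u, v]) (ball (0 : ℂ) (‖v‖ ^ k)) := by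
  have h1 := integrable_indicator_generalizedHartogsTriangle hk hF
  rw [ae_restrict_iff' measurableSet_punctured_ball]
  filter_upwards [h1.prod_left_ae] with v hv hmem
  simp only [indicator_generalizedHartogsTriangle_cons hk, indicator_of_mem hmem] at hv
  exact (integrable_indicator_iff measurableSet_ball).1 hv

variable [NormedSpace ℝ E]

theorem integral_generalizedHartogsTriangle (hk : 0 < k)
    (hF : IntegrableOn F (generalizedHartogsTriangle (1 / (k : ℝ)))) :
    ∫ z in generalizedHartogsTriangle (1 / (k : ℝ)), F z =
      ∫ v in ball (0 : ℂ) 1 \ {0}, ∫ u in ball (0 : ℂ) (‖v‖ ^ k), F ![u, v] := by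
  have h1 := integrable_indicator_generalizedHartogsTriangle hk hF
  rw [← integral_indicator (isOpen_generalizedHartogsTriangle hk).measurableSet,
    ← (volume_preserving_finTwoArrow ℂ).symm.integral_comp
      (MeasurableEquiv.measurableEmbedding _)]
  refine (integral_prod_symm _ h1).trans ?_
  rw [← integral_indicator measurableSet_punctured_ball]
  refine integral_congr_ae (Filter.Eventually.of_forall fun v => ?_)
  simp only [indicator_generalizedHartogsTriangle_cons hk]
  by_cases hv : v ∈ ball (0 : ℂ) 1 \ {0}
  · simp only [indicator_of_mem hv, integral_indicator measurableSet_ball]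
  · simp only [indicator_of_notMem hv, integral_zero]

theorem integrableOn_integral_slice_generalizedHartogsTriangle (hk : 0 < k)
    (hF : IntegrableOn F (generalizedHartogsTriangle (1 / (k : ℝ)))) :
    IntegrableOn (fun v => ∫ u in ball (0 : ℂ) (‖v‖ ^ k), F ![u, v])
      (ball (0 : ℂ) 1 \ {0}) := by
  have h1 := (integrable_indicator_generalizedHartogsTriangle hk hF).integral_prod_right
  rw [← integrable_indicator_iff measurableSet_punctured_ball]
  refine h1.congr (Filter.Eventually.of_forall fun v => ?_)
  simp only [indicator_generalizedHartogsTriangle_cons hk]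
  by_cases hv : v ∈ ball (0 : ℂ) 1 \ {0}
  · simp only [indicator_of_mem hv, integral_indicator measurableSet_ball]
  · simp only [indicator_of_notMem hv, integral_zero]

/-- This version presupposes no integrability, so it can establish that of the kernel. -/
theorem lintegral_generalizedHartogsTriangle (hk : 0 < k) {F : (Fin 2 → ℂ) → ENNReal}
    (hF : Measurable F) :
    ∫⁻ z in generalizedHartogsTriangle (1 / (k : ℝ)), F z =
      ∫⁻ v in ball (0 : ℂ) 1 \ {0}, ∫⁻ u in ball (0 : ℂ) (‖v‖ ^ k), F ![u, v] := by
  have hm := (isOpen_generalizedHartogsTriangle hk).measurableSet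
  have h1 : Measurable fun p : ℂ × ℂ =>
      (generalizedHartogsTriangle (1 / (k : ℝ))).indicator F ![p.1, p.2] :=
    (hF.indicator hm).comp (MeasurableEquiv.finTwoArrow (α := ℂ)).symm.measurable
  rw [← lintegral_indicator hm,
    ← (volume_preserving_finTwoArrow ℂ).symm.lintegral_comp_emb
      (MeasurableEquiv.measurableEmbedding _)]
  refine (lintegral_prod_symm' _ h1).trans ?_
  rw [← lintegral_indicator measurableSet_punctured_ball]
  refine lintegral_congr fun v => ?_
  simp only [indicator_generalizedHartogsTriangle_cons hk]
  by_cases hv : v ∈ ball (0 : ℂ) 1 \ {0}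
  · simp only [indicator_of_mem hv, lintegral_indicator measurableSet_ball]
  · simp only [indicator_of_notMem hv, lintegral_zero]

end Fubini

/-! ### The closed form: non-vanishing and square-integrability -/

open ComplexConjugate in
/-- The Bergman kernel of the Hartogs triangle of exponent `1 / k` in closed form. -/
noncomputable def hartogsBergmanKernel (k : ℕ) (z w : Fin 2 → ℂ) : ℂ :=
  (z 1 * conj (w 1)) ^ k / (Real.pi ^ 2 * ((z 1 * conj (w 1)) ^ k - z 0 * conj (w 0)) ^ 2 *
    (1 - z 1 * conj (w 1)) ^ 2)

section Kernel

open Complex Set Metric ComplexConjugate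

variable {k : ℕ} {z w : Fin 2 → ℂ}

theorem conj_hartogsBergmanKernel (k : ℕ) (z w : Fin 2 → ℂ) :
    conj (hartogsBergmanKernel k z w) = hartogsBergmanKernel k w z := by
  simp only [hartogsBergmanKernel, map_div₀, map_mul, map_pow, map_sub, map_one, conj_conj,
    conj_ofReal]
  rw [mul_comm (conj (z 1)), mul_comm (conj (z 0))]

/-- The quantitative form of non-vanishing: for fixed `w` it also controls the growth of the kernel
as `z 1` tends to `0`. -/
theorem le_norm_pow_sub_of_mem_generalizedHartogsTriangle (hk : 0 < k)
    (hz : z ∈ generalizedHartogsTriangle (1 / (k : ℝ))) :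
    ‖z 1‖ ^ k * (‖w 1‖ ^ k - ‖w 0‖) ≤ ‖(z 1 * conj (w 1)) ^ k - z 0 * conj (w 0)‖ := by
  have h1 := ((mem_generalizedHartogsTriangle_one_div hk).1 hz).1
  have h2 := norm_sub_norm_le ((z 1 * conj (w 1)) ^ k) (z 0 * conj (w 0))
  rw [norm_pow, norm_mul, norm_mul, norm_conj, norm_conj, mul_pow] at h2
  have h3 : ‖z 0‖ * ‖w 0‖ ≤ ‖z 1‖ ^ k * ‖w 0‖ := by gcongr
  linarith

theorem le_norm_one_sub_of_mem_generalizedHartogsTriangle (hk : 0 < k)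
    (hz : z ∈ generalizedHartogsTriangle (1 / (k : ℝ))) :
    1 - ‖w 1‖ ≤ ‖1 - z 1 * conj (w 1)‖ := by
  have h1 := ((mem_generalizedHartogsTriangle_one_div hk).1 hz).2
  have h2 := norm_sub_norm_le (1 : ℂ) (z 1 * conj (w 1))
  rw [norm_mul, norm_conj, norm_one] at h2
  have h3 : ‖z 1‖ * ‖w 1‖ ≤ 1 * ‖w 1‖ := by gcongr
  linarith

theorem pow_sub_ne_zero_of_mem_generalizedHartogsTriangle (hk : 0 < k)
    (hz : z ∈ generalizedHartogsTriangle (1 / (k : ℝ)))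
    (hw : w ∈ generalizedHartogsTriangle (1 / (k : ℝ))) :
    (z 1 * conj (w 1)) ^ k - z 0 * conj (w 0) ≠ 0 := by
  have h1 := sub_pos.2 ((mem_generalizedHartogsTriangle_one_div hk).1 hw).1
  have h2 := pow_pos (norm_pos_iff.2 (ne_zero_of_mem_generalizedHartogsTriangle hk hz)) k
  exact norm_pos_iff.1 ((mul_pos h2 h1).trans_le
    (le_norm_pow_sub_of_mem_generalizedHartogsTriangle hk hz))

theorem one_sub_ne_zero_of_mem_generalizedHartogsTriangle (hk : 0 < k)
    (hz : z ∈ generalizedHartogsTriangle (1 / (k : ℝ)))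
    (hw : w ∈ generalizedHartogsTriangle (1 / (k : ℝ))) :
    1 - z 1 * conj (w 1) ≠ 0 := by
  have h1 := sub_pos.2 ((mem_generalizedHartogsTriangle_one_div hk).1 hw).2
  exact norm_pos_iff.1 (h1.trans_le (le_norm_one_sub_of_mem_generalizedHartogsTriangle hk hz))

theorem hartogsBergmanKernel_ne_zero (hk : 0 < k)
    (hz : z ∈ generalizedHartogsTriangle (1 / (k : ℝ)))
    (hw : w ∈ generalizedHartogsTriangle (1 / (k : ℝ))) :
    hartogsBergmanKernel k z w ≠ 0 := by
  refine div_ne_zero (pow_ne_zero k (mul_ne_zero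
    (ne_zero_of_mem_generalizedHartogsTriangle hk hz) ?_)) (mul_ne_zero (mul_ne_zero ?_ ?_) ?_)
  · exact (map_ne_zero _).2 (ne_zero_of_mem_generalizedHartogsTriangle hk hw)
  · exact pow_ne_zero 2 (ofReal_ne_zero.2 Real.pi_ne_zero)
  · exact pow_ne_zero 2 (pow_sub_ne_zero_of_mem_generalizedHartogsTriangle hk hz hw)
  · exact pow_ne_zero 2 (one_sub_ne_zero_of_mem_generalizedHartogsTriangle hk hz hw)

theorem differentiableOn_hartogsBergmanKernel (hk : 0 < k)
    (hw : w ∈ generalizedHartogsTriangle (1 / (k : ℝ))) :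
    DifferentiableOn ℂ (fun z => hartogsBergmanKernel k z w)
      (generalizedHartogsTriangle (1 / (k : ℝ))) := by
  unfold hartogsBergmanKernel
  simp only [div_eq_mul_inv]
  refine DifferentiableOn.fun_mul ?_ (DifferentiableOn.fun_inv ?_ fun z hz => ?_)
  · exact Differentiable.differentiableOn (by fun_prop)
  · exact Differentiable.differentiableOn (by fun_prop)
  refine mul_ne_zero (mul_ne_zero ?_ ?_) ?_
  · exact pow_ne_zero 2 (ofReal_ne_zero.2 Real.pi_ne_zero)
  · exact pow_ne_zero 2 (pow_sub_ne_zero_of_mem_generalizedHartogsTriangle hk hz hw)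
  · exact pow_ne_zero 2 (one_sub_ne_zero_of_mem_generalizedHartogsTriangle hk hz hw)

theorem norm_hartogsBergmanKernel_le (hk : 0 < k)
    (hz : z ∈ generalizedHartogsTriangle (1 / (k : ℝ)))
    (hw : w ∈ generalizedHartogsTriangle (1 / (k : ℝ))) :
    ‖hartogsBergmanKernel k z w‖ ≤
      (Real.pi ^ 2 * (‖w 1‖ ^ k - ‖w 0‖) ^ 2 * (1 - ‖w 1‖) ^ 2)⁻¹ * (‖z 1‖ ^ k)⁻¹ := by
  have hw' := (mem_generalizedHartogsTriangle_one_div hk).1 hw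
  have hδ := sub_pos.2 hw'.1
  have hε := sub_pos.2 hw'.2
  have hz1 : 0 < ‖z 1‖ ^ k :=
    pow_pos (norm_pos_iff.2 (ne_zero_of_mem_generalizedHartogsTriangle hk hz)) k
  have h1 := le_norm_pow_sub_of_mem_generalizedHartogsTriangle (w := w) hk hz
  have h2 := le_norm_one_sub_of_mem_generalizedHartogsTriangle (w := w) hk hz
  have hpi := Real.pi_pos
  rw [hartogsBergmanKernel, norm_div, norm_mul, norm_mul, norm_pow, norm_pow, norm_pow, norm_pow,
    norm_mul, norm_conj, norm_real, Real.norm_of_nonneg hpi.le]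
  calc (‖z 1‖ * ‖w 1‖) ^ k / (Real.pi ^ 2 *
        ‖(z 1 * conj (w 1)) ^ k - z 0 * conj (w 0)‖ ^ 2 * ‖1 - z 1 * conj (w 1)‖ ^ 2)
      ≤ ‖z 1‖ ^ k / (Real.pi ^ 2 * (‖z 1‖ ^ k * (‖w 1‖ ^ k - ‖w 0‖)) ^ 2 * (1 - ‖w 1‖) ^ 2) := by
        gcongr
        exact mul_le_of_le_one_right (norm_nonneg _) hw'.2.le
    _ = _ := by field_simp

theorem hartogsBergmanKernel_mem_bergmanSpace (hk : 0 < k)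
    (hw : w ∈ generalizedHartogsTriangle (1 / (k : ℝ))) :
    (fun z => hartogsBergmanKernel k z w) ∈
      bergmanSpace (generalizedHartogsTriangle (1 / (k : ℝ))) := by
  have hm := (isOpen_generalizedHartogsTriangle hk).measurableSet
  have hd := differentiableOn_hartogsBergmanKernel hk hw
  refine ⟨hd, ?_⟩
  set C := (Real.pi ^ 2 * (‖w 1‖ ^ k - ‖w 0‖) ^ 2 * (1 - ‖w 1‖) ^ 2)⁻¹
  have hbd : MemLp (fun z : Fin 2 → ℂ => C * (‖z 1‖ ^ k)⁻¹) 2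
      (volume.restrict (generalizedHartogsTriangle (1 / (k : ℝ)))) := by
    refine MemLp.const_mul ?_ C
    have hmeas : Measurable fun z : Fin 2 → ℂ => (‖z 1‖ ^ k)⁻¹ := by fun_prop
    rw [memLp_two_iff_integrable_sq_norm hmeas.aestronglyMeasurable]
    refine ⟨(hmeas.norm.pow_const 2).aestronglyMeasurable, ?_⟩
    rw [hasFiniteIntegral_iff_enorm,
      lintegral_generalizedHartogsTriangle hk (hmeas.norm.pow_const 2).enorm]
    -- The fibre has area `π * ‖v‖ ^ (2 * k)`, which exactly cancels the squared bound.
    have h1 : ∀ v ∈ ball (0 : ℂ) 1 \ {0}, ∫⁻ u in ball (0 : ℂ) (‖v‖ ^ k),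
        ‖‖(‖(![u, v] : Fin 2 → ℂ) 1‖ ^ k)⁻¹‖ ^ 2‖ₑ = NNReal.pi := by
      intro v hv
      have hv0 : 0 < ‖v‖ ^ k := pow_pos (norm_pos_iff.2 hv.2) k
      simp only [Matrix.cons_val_one, Matrix.cons_val_fin_one]
      rw [setLIntegral_const, Complex.volume_ball, ← mul_assoc,
        Real.enorm_eq_ofReal (by positivity), norm_inv, Real.norm_of_nonneg hv0.le,
        ← ENNReal.ofReal_pow hv0.le, ← ENNReal.ofReal_mul (by positivity), ← mul_pow,
        inv_mul_cancel₀ hv0.ne']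
      simp
    rw [setLIntegral_congr_fun measurableSet_punctured_ball h1, setLIntegral_const]
    exact ENNReal.mul_lt_top ENNReal.coe_lt_top
      ((measure_mono sdiff_subset).trans_lt measure_ball_lt_top)
  refine hbd.mono (hd.continuousOn.aestronglyMeasurable hm) ?_
  filter_upwards [ae_restrict_mem hm] with z hz
  exact (norm_hartogsBergmanKernel_le hk hz hw).trans (Real.le_norm_self _)

/-- The factorization follows from `‖v‖ ^ (2 * k) = v ^ k * conj v ^ k`; the last factor is the
kernel of the fibre disc at `z 0 / z 1 ^ k * v ^ k`. -/
theorem hartogsBergmanKernel_cons (hz : z 1 ≠ 0) {u v : ℂ} (hv : v ≠ 0) :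
    hartogsBergmanKernel k z ![u, v] =
      (z 1 ^ k)⁻¹ * (1 / (Real.pi * (1 - z 1 * conj v) ^ 2)) * v ^ k *
        (((‖v‖ ^ k : ℝ) : ℂ) ^ 2 /
          (Real.pi * (((‖v‖ ^ k : ℝ) : ℂ) ^ 2 - z 0 / z 1 ^ k * v ^ k * conj u) ^ 2)) := by
  have hR : (((‖v‖ ^ k : ℝ) : ℂ)) ^ 2 = v ^ k * conj v ^ k := by
    rw [← mul_pow, mul_conj, normSq_eq_norm_sq]
    push_cast; ring
  have hz' : z 1 ^ k ≠ 0 := pow_ne_zero k hz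
  have hv' : v ^ k ≠ 0 := pow_ne_zero k hv
  have h1 : v ^ k * conj v ^ k - z 0 / z 1 ^ k * v ^ k * conj u =
      v ^ k / z 1 ^ k * ((z 1 * conj v) ^ k - z 0 * conj u) := by
    rw [mul_pow]; field_simp
  simp only [hartogsBergmanKernel, Matrix.cons_val_zero, Matrix.cons_val_one,
    Matrix.cons_val_fin_one]
  rw [hR, h1]
  generalize (z 1 * conj v) ^ k - z 0 * conj u = X
  generalize 1 - z 1 * conj v = Y
  rw [mul_pow (z 1)]
  have hpi : (Real.pi : ℂ) ≠ 0 := ofReal_ne_zero.2 Real.pi_ne_zero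
  -- If a denominator vanishes, both sides are `0` by the convention for division.
  rcases eq_or_ne X 0 with rfl | hX
  · simp
  rcases eq_or_ne Y 0 with rfl | hY
  · simp
  field_simp

end Kernel

/-! ### The reproducing property -/

section Reproducing

open Complex Set Metric ComplexConjugate

variable {k : ℕ} {f : (Fin 2 → ℂ) → ℂ}

/-- The square `f ^ 2` is holomorphic, unlike `‖f‖ ^ 2`, so reproducing formulas for integrable
functions apply to it on fibres. -/
theorem integrableOn_sq_of_mem_bergmanSpace {n : ℕ} {Ω : Set (Fin n → ℂ)}
    {f : (Fin n → ℂ) → ℂ} (hf : f ∈ bergmanSpace Ω) : IntegrableOn (fun z => f z ^ 2) Ω := by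
  have := hf.2.integrable_mul hf.2
  simpa only [IntegrableOn, sq] using! this

theorem differentiableOn_slice_generalizedHartogsTriangle (hk : 0 < k)
    (hf : DifferentiableOn ℂ f (generalizedHartogsTriangle (1 / (k : ℝ)))) {v : ℂ}
    (hv : v ∈ ball (0 : ℂ) 1 \ {0}) :
    DifferentiableOn ℂ (fun u => f ![u, v]) (ball 0 (‖v‖ ^ k)) := by
  refine hf.comp (t := generalizedHartogsTriangle (1 / (k : ℝ))) (f := fun u => ![u, v]) ?_
    fun u hu => (cons_mem_generalizedHartogsTriangle_iff hk).2 ⟨hv, hu⟩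
  refine Differentiable.differentiableOn (differentiable_pi.2 fun i => ?_)
  fin_cases i
  · exact differentiable_id
  · exact differentiable_const v

theorem norm_mul_pow_lt {c v : ℂ} (hc : ‖c‖ < 1) (hv : v ≠ 0) : ‖c * v ^ k‖ < ‖v‖ ^ k := by
  rw [norm_mul, norm_pow]
  exact mul_lt_of_lt_one_left (pow_pos (norm_pos_iff.2 hv) k) hc

theorem differentiableOn_curve_generalizedHartogsTriangle (hk : 0 < k)
    (hf : DifferentiableOn ℂ f (generalizedHartogsTriangle (1 / (k : ℝ)))) {c : ℂ}
    (hc : ‖c‖ < 1) :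
    DifferentiableOn ℂ (fun v => v ^ k * f ![c * v ^ k, v]) (ball 0 1 \ {0}) := by
  refine DifferentiableOn.fun_mul (Differentiable.differentiableOn (by fun_prop)) ?_
  refine hf.comp (t := generalizedHartogsTriangle (1 / (k : ℝ)))
    (f := fun v => ![c * v ^ k, v]) ?_
    fun v hv => (cons_mem_generalizedHartogsTriangle_iff hk).2 ⟨hv, ?_⟩
  · refine Differentiable.differentiableOn (differentiable_pi.2 fun i => ?_)
    fin_cases i
    · exact (differentiable_id.pow k).const_mul c
    · exact differentiable_id
  · exact mem_ball_zero_iff.2 (norm_mul_pow_lt hc hv.2)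

/-- The disc formula applied to `h ^ 2` gives a point evaluation bound of order `‖v‖ ^ (-2 * k)`,
and the factor `v ^ k` compensates for it uniformly in `v`. -/
theorem norm_sq_curve_le {c v : ℂ} (hc : ‖c‖ < 1) (hv : v ≠ 0) {h : ℂ → ℂ}
    (hh : DifferentiableOn ℂ h (ball 0 (‖v‖ ^ k)))
    (hi : IntegrableOn (fun u => h u ^ 2) (ball 0 (‖v‖ ^ k))) :
    ‖(v ^ k * h (c * v ^ k)) ^ 2‖ ≤
      (Real.pi * (1 - ‖c‖) ^ 2)⁻¹ * ∫ u in ball 0 (‖v‖ ^ k), ‖h u ^ 2‖ := by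
  set R : ℝ := ‖v‖ ^ k with hR
  have hR0 : 0 < R := pow_pos (norm_pos_iff.2 hv) k
  have hc' : 0 < 1 - ‖c‖ := sub_pos.2 hc
  have hpi := Real.pi_pos
  have key := integral_ball_bergman_mul (hh.pow 2) hi (norm_mul_pow_lt hc hv)
  have hK : ∀ u ∈ ball (0 : ℂ) R, ‖(R : ℂ) ^ 2 / (Real.pi * (R ^ 2 - c * v ^ k * conj u) ^ 2)‖ ≤
      (Real.pi * (1 - ‖c‖) ^ 2)⁻¹ * (R ^ 2)⁻¹ := by
    intro u hu
    rw [mem_ball_zero_iff] at hu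
    have h1 : R ^ 2 * (1 - ‖c‖) ≤ ‖(R : ℂ) ^ 2 - c * v ^ k * conj u‖ := by
      have h2 := norm_sub_norm_le ((R : ℂ) ^ 2) (c * v ^ k * conj u)
      rw [norm_mul, norm_mul, norm_conj, norm_pow, norm_pow, norm_real, ← hR,
        Real.norm_of_nonneg hR0.le] at h2
      have h3 : ‖c‖ * R * ‖u‖ ≤ ‖c‖ * R * R := by gcongr
      linarith
    rw [norm_div, norm_mul, norm_pow, norm_pow, norm_real, norm_real,
      Real.norm_of_nonneg hR0.le, Real.norm_of_nonneg hpi.le]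
    calc R ^ 2 / (Real.pi * ‖(R : ℂ) ^ 2 - c * v ^ k * conj u‖ ^ 2)
        ≤ R ^ 2 / (Real.pi * (R ^ 2 * (1 - ‖c‖)) ^ 2) := by gcongr
      _ = _ := by field_simp
  have h1 : ‖h (c * v ^ k) ^ 2‖ ≤
      (Real.pi * (1 - ‖c‖) ^ 2)⁻¹ * (R ^ 2)⁻¹ * ∫ u in ball 0 R, ‖h u ^ 2‖ := by
    have h2 : h (c * v ^ k) ^ 2 = (h ^ 2) (c * v ^ k) := rfl
    rw [h2, ← key, ← integral_const_mul]
    refine norm_integral_le_of_norm_le (hi.norm.const_mul _) ?_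
    filter_upwards [ae_restrict_mem measurableSet_ball] with u hu
    rw [norm_mul]
    exact mul_le_mul_of_nonneg_right (hK u hu) (norm_nonneg _)
  calc ‖(v ^ k * h (c * v ^ k)) ^ 2‖ = R ^ 2 * ‖h (c * v ^ k) ^ 2‖ := by
        rw [mul_pow, norm_mul, norm_pow, norm_pow]
    _ ≤ R ^ 2 * ((Real.pi * (1 - ‖c‖) ^ 2)⁻¹ * (R ^ 2)⁻¹ * ∫ u in ball 0 R, ‖h u ^ 2‖) := by
        gcongr
    _ = _ := by field_simp

/-- The fibre integrals of `‖f ^ 2‖` dominate, and these are integrable in `v` by Fubini. -/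
theorem integrableOn_sq_curve (hk : 0 < k)
    (hf : f ∈ bergmanSpace (generalizedHartogsTriangle (1 / (k : ℝ)))) {c : ℂ} (hc : ‖c‖ < 1) :
    IntegrableOn (fun v => (v ^ k * f ![c * v ^ k, v]) ^ 2) (ball 0 1 \ {0}) := by
  have hsq := integrableOn_sq_of_mem_bergmanSpace hf
  have hdom := (integrableOn_integral_slice_generalizedHartogsTriangle hk hsq.norm).const_mul
    (Real.pi * (1 - ‖c‖) ^ 2)⁻¹
  have hcont : ContinuousOn (fun v => (v ^ k * f ![c * v ^ k, v]) ^ 2) (ball 0 1 \ {0}) :=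
    (differentiableOn_curve_generalizedHartogsTriangle hk hf.1 hc).continuousOn.pow 2
  refine Integrable.mono' hdom
    (hcont.aestronglyMeasurable measurableSet_punctured_ball) ?_
  filter_upwards [ae_restrict_mem measurableSet_punctured_ball,
    integrableOn_slice_generalizedHartogsTriangle hk hsq] with v hv hvi
  exact norm_sq_curve_le (h := fun u => f ![u, v]) hc hv.2
    (differentiableOn_slice_generalizedHartogsTriangle hk hf.1 hv) hvi

theorem integral_hartogsBergmanKernel_mul (hk : 0 < k)
    (hf : f ∈ bergmanSpace (generalizedHartogsTriangle (1 / (k : ℝ)))) {z : Fin 2 → ℂ}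
    (hz : z ∈ generalizedHartogsTriangle (1 / (k : ℝ))) :
    ∫ w in generalizedHartogsTriangle (1 / (k : ℝ)), hartogsBergmanKernel k z w * f w = f z := by
  have hz1 := ne_zero_of_mem_generalizedHartogsTriangle hk hz
  have hzk : z 1 ^ k ≠ 0 := pow_ne_zero k hz1
  have hz' := (mem_generalizedHartogsTriangle_one_div hk).1 hz
  set c := z 0 / z 1 ^ k with hcdef
  have hc : ‖c‖ < 1 := by
    rw [hcdef, norm_div, norm_pow, div_lt_one (pow_pos (norm_pos_iff.2 hz1) k)]
    exact hz'.1
  have hsq := integrableOn_sq_of_mem_bergmanSpace hf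
  -- Square-integrability in the second variable comes from the first by conjugate symmetry.
  have hB : MemLp (fun w => hartogsBergmanKernel k z w) 2
      (volume.restrict (generalizedHartogsTriangle (1 / (k : ℝ)))) := by
    have := (hartogsBergmanKernel_mem_bergmanSpace hk hz).2.star
    refine this.ae_eq (Filter.Eventually.of_forall fun w => ?_)
    exact conj_hartogsBergmanKernel k w z
  have hint : IntegrableOn (fun w => hartogsBergmanKernel k z w * f w)
      (generalizedHartogsTriangle (1 / (k : ℝ))) := hB.integrable_mul hf.2
  -- Only almost every `v`, since Fubini gives integrability of `f ^ 2` on almost every fibre.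
  have hinner : ∀ᵐ v ∂volume.restrict (ball (0 : ℂ) 1 \ {0}),
      ∫ u in ball (0 : ℂ) (‖v‖ ^ k), hartogsBergmanKernel k z ![u, v] * f ![u, v] =
        (z 1 ^ k)⁻¹ * (1 / (Real.pi * (1 - z 1 * conj v) ^ 2) *
          (v ^ k * f ![c * v ^ k, v])) := by
    filter_upwards [ae_restrict_mem measurableSet_punctured_ball,
      integrableOn_slice_generalizedHartogsTriangle hk hsq] with v hv hvi
    have hd := differentiableOn_slice_generalizedHartogsTriangle hk hf.1 hv
    have hi := integrableOn_of_sq measurableSet_ball measure_ball_lt_top.ne hd.continuousOn hvi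
    simp only [hartogsBergmanKernel_cons hz1 hv.2, mul_assoc]
    simp only [integral_const_mul]
    have key := integral_ball_bergman_mul hd hi (norm_mul_pow_lt hc hv.2)
    rw [← key, ← hcdef]
    simp only [mul_assoc]
  rw [integral_generalizedHartogsTriangle hk hint, integral_congr_ae hinner, integral_const_mul,
    integral_punctured_ball_bergman_mul (differentiableOn_curve_generalizedHartogsTriangle hk hf.1
      hc) (integrableOn_sq_curve hk hf hc) hz'.2 hz1, ← mul_assoc, inv_mul_cancel₀ hzk, one_mul,
    hcdef, div_mul_cancel₀ _ hzk]
  congr 1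
  funext i
  fin_cases i <;> rfl

theorem isBergmanKernel_hartogsBergmanKernel (hk : 0 < k) :
    IsBergmanKernel (generalizedHartogsTriangle (1 / (k : ℝ))) (hartogsBergmanKernel k) where
  mem _ hw := hartogsBergmanKernel_mem_bergmanSpace hk hw
  conj_symm z _ w _ := (conj_hartogsBergmanKernel k z w).symm
  reproducing _ hf _ hz := (integral_hartogsBergmanKernel_mul hk hf hz).symm

end Reproducing

theorem mainTheorem3 (k : ℕ) (hk : 0 < k) :
    IsLuQiKengDomain (generalizedHartogsTriangle (1 / (k : ℝ))) where
  isOpen := isOpen_generalizedHartogsTriangle hk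
  isConnected := isConnected_generalizedHartogsTriangle hk
  kernel_ne_zero z hz w hw := by
    rw [(isBergmanKernel_hartogsBergmanKernel hk).bergmanKernel_eq
      (isOpen_generalizedHartogsTriangle hk) hz hw]
    exact hartogsBergmanKernel_ne_zero hk hz hw
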